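/- Let $n$ and $q$ be positive integers with $n$ odd and $n\mid q$. Consider the vector configuration $A=A_{n-1}=\{e_i-e_j : 1\le i<j\le n\}$ of positive roots in the weight lattice $\Lambda_W=\mathbb{Z}\{e_1,\dots,e_n\}/(e_1+\cdots+e_n=0)$, which is a lattice of rank $n-1$ in the real vector space $\mathbb{R}^n/(e_1+\cdots+e_n=0)$. For $B\subseteq A$ let $r(B)=\dim_{\mathbb{R}}\operatorname{span}B$ and let $m(B)=[\operatorname{span}B\cap\Lambda_W:\mathbb{Z}B]$. Let $$M^W_{A_{n-1}}(x,y)=\sum_{B\subseteq A} m(B)\,(x-1)^{r(A)-r(B)}(y-1)^{|B|-r(B)}$$ be the arithmetic Tutte polynomial of $A$ in $\Lambda_W$, and let $$\chi^W_{A_{n-1}}(t)=(-1)^{r}\,t^{d-r}\,M^W_{A_{n-1}}(1-t,0),\qquad r=r(A),\quad d=\operatorname{rank}\Lambda_W,$$ be its arithmetic characteristic polynomial (here $d=r=n-1$). Then $\chi^W_{A_{n-1}}(q)/n!$ equals the number of cyclic necklaces, counted up to rotation only, with $n$ black beads and $q-n$ white beads. -/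

import Mathlib

open Polynomial

noncomputable section

namespace ArithTutte

section General

variable {V ι : Type*} [AddCommGroup V] [Module ℝ V]

/-- The rank `r(B) = dim span B` of a subset `B` of a vector configuration `A = (A i)_{i ∈ ι}`. -/
def rank (A : ι → V) (B : Finset ι) : ℕ :=
  Module.finrank ℝ (Submodule.span ℝ (A '' (B : Set ι)))

/-- The multiplicity `m(B) = [span B ∩ Λ : ℤB]`. -/
def latticeMultiplicity (L : AddSubgroup V) (A : ι → V) (B : Finset ι) : ℕ :=
  (AddSubgroup.closure (A '' (B : Set ι))).relIndex
    ((Submodule.span ℝ (A '' (B : Set ι))).toAddSubgroup ⊓ L)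

/-- The arithmetic Tutte polynomial
`M(x, y) = ∑_{B ⊆ A} m(B) (x - 1)^(r(A) - r(B)) (y - 1)^(|B| - r(B))` of a finite vector
configuration `A` in the lattice `L`, with `x = X 0` and `y = X 1`. -/
def arithmeticTutte [Fintype ι] (L : AddSubgroup V) (A : ι → V) : MvPolynomial (Fin 2) ℤ :=
  ∑ B : Finset ι, MvPolynomial.C (latticeMultiplicity L A B : ℤ) *
    (MvPolynomial.X 0 - 1) ^ (rank A Finset.univ - rank A B) *
    (MvPolynomial.X 1 - 1) ^ (B.card - rank A B)

/-- The arithmetic characteristic polynomial `χ(q) = (-1)^r q^(d - r) M(1 - q, 0)`, where `d` is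
the rank of the lattice `L` and `r` is the rank of the configuration `A`. -/
def arithmeticCharPoly [Fintype ι] (L : AddSubgroup V) (A : ι → V) : ℤ[X] :=
  (-1) ^ rank A Finset.univ * X ^ (Module.finrank ℤ L - rank A Finset.univ) *
    MvPolynomial.aeval ![1 - X, 0] (arithmeticTutte L A)

end General

/-- The real vector space `ℝ^n / (e_1 + ⋯ + e_n = 0)`. -/
abbrev TypeASpace (n : ℕ) : Type :=
  (Fin n → ℝ) ⧸ Submodule.span ℝ {(1 : Fin n → ℝ)}

/-- The class of the standard basis vector `e_i` in `ℝ^n / (e_1 + ⋯ + e_n = 0)`. -/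
def basisVec (n : ℕ) (i : Fin n) : TypeASpace n :=
  Submodule.Quotient.mk (Pi.single i 1)

/-- The weight lattice `Λ_W(A_{n-1}) = ℤ{e_1, …, e_n} / (e_1 + ⋯ + e_n = 0)`. -/
def weightLatticeA (n : ℕ) : AddSubgroup (TypeASpace n) :=
  AddSubgroup.closure (Set.range (basisVec n))

/-- The configuration `A_{n-1} = {e_i - e_j : i < j}` of positive roots (these vectors are pairwise
distinct, so the family indexed by the pairs `i < j` is the same as the set). -/
def positiveRootsA (n : ℕ) (p : {p : Fin n × Fin n // p.1 < p.2}) : TypeASpace n :=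
  basisVec n p.1.1 - basisVec n p.1.2

/-- The polynomial `χ^W_{A_{n-1}}`. -/
def charPolyWeightA (n : ℕ) : ℤ[X] :=
  arithmeticCharPoly (weightLatticeA n) (positiveRootsA n)

/-- The set of cyclic necklaces (up to rotation, not reflection) with `b` black beads (`true`) and
`w` white beads (`false`). -/
def necklaces (b w : ℕ) : Set (Cycle Bool) :=
  {c | c.toMultiset.count true = b ∧ c.toMultiset.count false = w}

end ArithTutte

end

/-! Both sides are evaluated as the same sum over `t : ZMod q`; no bijection is built. View `B ⊆ A`
as a graph on `Fin n` with `c` components. Its rank is `n - c`, and its multiplicity is the gcd `g`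
of the component sizes (`latticeMultiplicity_positiveRootsA`), so `χ(q) = ∑ (-1)^|B| g q^(c-1)`.
Since `g ∣ n ∣ q`, the number `g q^(c-1)` counts the zero-sum tuples in `ZMod q` that are constant
on components (`card_sum_eq_zero_of_constant`). Inclusion-exclusion leaves the injective zero-sum
tuples, so `χ(q) / n!` counts the `n`-subsets of `ZMod q` with sum zero. Character orthogonality
turns `q` times that count into a sum over `t` of the `X^n` coefficient of `(1 - (-X)^d)^(q/d)`,
where `d` is the order of `t`. For `n` odd this coefficient is `(q/d).choose (n/d)` if `d ∣ n` and
zero otherwise (`modulus_mul_card_sum_eq_zero`). It is also the number of `n`-subsets fixed by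
translation by `t`, so by Burnside the sum is `q` times the number of translation orbits
(`card_orbits_mul_card`). These orbits are the necklaces (`ncard_necklaces`). -/

noncomputable section

namespace ArithTutte

open Finset

/-! ### Sums along fibers, and the span of edge vectors of a graph -/

section FiberSum

open scoped Classical in
/-- Summation of a vector along the fibers of `f`. -/
def fiberSum (R : Type*) [CommRing R] {α β : Type*} [Fintype α] (f : α → β) :
    (α → R) →ₗ[R] (β → R) where
  toFun x c := ∑ i with f i = c, x i
  map_add' x y := by ext c; simp [sum_add_distrib]
  map_smul' a x := by ext c; simp [mul_sum]

variable {R α β : Type*} [CommRing R] [Fintype α]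

open scoped Classical in
theorem fiberSum_apply (f : α → β) (x : α → R) (c : β) :
    fiberSum R f x c = ∑ i with f i = c, x i := rfl

theorem fiberSum_single [DecidableEq α] [DecidableEq β] (f : α → β) (i : α) (a : R) :
    fiberSum R f (Pi.single i a) = Pi.single (f i) a := by
  ext c
  rw [fiberSum_apply]
  by_cases h : f i = c
  · subst h; simp
  · rw [Pi.single_eq_of_ne (Ne.symm h)]
    refine Finset.sum_eq_zero fun j hj => Pi.single_eq_of_ne ?_ _
    rintro rfl
    exact h (by simpa using hj)

theorem fiberSum_surjective [Finite β] {f : α → β} (hf : Function.Surjective f) :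
    Function.Surjective (fiberSum R f) := by
  classical
  have := Fintype.ofFinite β
  intro y
  refine ⟨∑ c, Pi.single (Function.surjInv hf c) (y c), ?_⟩
  simp only [map_sum, fiberSum_single, Function.surjInv_eq]
  exact Finset.univ_sum_single y

theorem sum_fiberSum [Fintype β] (f : α → β) (x : α → R) :
    ∑ c, fiberSum R f x c = ∑ i, x i := by
  classical
  simp only [fiberSum_apply]
  convert Finset.sum_fiberwise univ f x

theorem finrank_ker_fiberSum [Fintype β] {f : α → β} (hf : Function.Surjective f) :
    Module.finrank ℝ (LinearMap.ker (fiberSum ℝ f)) + Fintype.card β = Fintype.card α := by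
  have h := LinearMap.finrank_range_add_finrank_ker (fiberSum ℝ f)
  rw [LinearMap.range_eq_top.2 (fiberSum_surjective hf), finrank_top, Module.finrank_pi,
    Module.finrank_pi] at h
  omega

/-- The number of elements in the fiber of `f` over `c`. -/
def fiberCard {α β : Type*} (f : α → β) (c : β) : ℕ := Nat.card {i // f i = c}

theorem fiberCard_eq [DecidableEq β] (f : α → β) (c : β) :
    fiberCard f c = #{i | f i = c} := by
  rw [fiberCard, Nat.card_eq_fintype_card, Fintype.card_subtype]

theorem sum_fiberCard [Fintype β] (f : α → β) : ∑ c, fiberCard f c = Fintype.card α := by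
  classical
  simp only [fiberCard_eq]
  rw [← Finset.card_univ, Finset.card_eq_sum_card_fiberwise (f := f) (t := univ) (by simp)]

theorem fiberCard_pos {f : α → β} (hf : Function.Surjective f) (c : β) : 0 < fiberCard f c := by
  obtain ⟨i, hi⟩ := hf c
  have : Nonempty {i // f i = c} := ⟨⟨i, hi⟩⟩
  exact Nat.card_pos

theorem fiberSum_const (f : α → β) (a : R) (c : β) :
    fiberSum R f (fun _ => a) c = a * fiberCard f c := by
  classical
  simp [fiberSum_apply, fiberCard_eq, mul_comm]

/-- The greatest common divisor of the fiber cardinalities of `f`. -/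
def fiberGcd [Fintype β] (f : α → β) : ℕ := univ.gcd (fiberCard f)

theorem fiberGcd_dvd {α β : Type*} [Fintype β] (f : α → β) (c : β) : fiberGcd f ∣ fiberCard f c :=
  Finset.gcd_dvd (mem_univ c)

theorem fiberGcd_dvd_card [Fintype β] (f : α → β) : fiberGcd f ∣ Fintype.card α := by
  rw [← sum_fiberCard f]
  exact Finset.dvd_sum fun c _ => fiberGcd_dvd f c

/-- Bézout over `ℤ`; the remaining work identifies the normalized gcd in `ℤ` with the gcd in `ℕ`. -/
theorem exists_sum_mul_eq_fiberGcd {α β : Type*} [Fintype β] (f : α → β) :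
    ∃ a : β → ℤ, ∑ c, a c * fiberCard f c = fiberGcd f := by
  obtain ⟨a, ha⟩ := Finset.gcd_eq_sum_mul (univ : Finset β) (fun c => (fiberCard f c : ℤ))
  refine ⟨a, ?_⟩
  simp only [mul_comm (a _)]
  rw [← ha]
  refine Int.dvd_antisymm ?_ (Int.natCast_nonneg _) ?_ ?_
  · rw [← Finset.normalize_gcd]; exact Int.nonneg_of_normalize_eq_self (normalize_idem _)
  · rw [← Int.natAbs_dvd, Int.natCast_dvd_natCast]
    exact Finset.dvd_gcd fun c _ => Int.natCast_dvd_natCast.1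
      (Int.natAbs_dvd.2 (Finset.gcd_dvd (mem_univ c)))
  · exact Finset.dvd_gcd fun c _ => Int.natCast_dvd_natCast.2 (fiberGcd_dvd f c)

theorem fiberSum_quotient_eq_zero_of_rel [DecidableEq α] {s : Setoid α} {i j : α} (h : s i j) :
    fiberSum R (Quotient.mk s) (Pi.single i 1 - Pi.single j 1) = 0 := by
  classical
  rw [map_sub, fiberSum_single, fiberSum_single, Quotient.sound h, sub_self]

/-- Differences of basis vectors along the edges of a graph span the vectors whose sum over each
connected component vanishes. -/
theorem span_single_sub_single_eq_ker [DecidableEq α] (r : α → α → Prop) :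
    Submodule.span R {v : α → R | ∃ i j, r i j ∧ v = Pi.single i 1 - Pi.single j 1} =
      LinearMap.ker (fiberSum R (Quotient.mk (Relation.EqvGen.setoid r))) := by
  classical
  set s := Relation.EqvGen.setoid r
  apply le_antisymm
  · rw [Submodule.span_le]
    rintro _ ⟨i, j, h, rfl⟩
    exact fiberSum_quotient_eq_zero_of_rel (Relation.EqvGen.rel _ _ h)
  · intro x hx
    set S := Submodule.span R {v : α → R | ∃ i j, r i j ∧ v = Pi.single i 1 - Pi.single j 1}
    have key : ∀ i j, Relation.EqvGen r i j →
        (Pi.single i 1 - Pi.single j 1 : α → R) ∈ S := by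
      intro i j h
      induction h with
      | rel i j h => exact Submodule.subset_span ⟨i, j, h, rfl⟩
      | refl i => simp
      | symm i j _ ih => simpa using S.neg_mem ih
      | trans i j k _ _ h1 h2 => simpa using S.add_mem h1 h2
    let rep : Quotient s → α := Quotient.out
    -- Moving every basis vector to the representative of its component collects the fiber sums as
    -- coefficients, and these vanish for `x` in the kernel.
    have hzero : ∑ i, x i • (Pi.single (rep (Quotient.mk s i)) 1 : α → R) = 0 := by
      rw [← Finset.sum_fiberwise _ (Quotient.mk s)]
      refine Finset.sum_eq_zero fun c _ => ?_
      have h : ∀ i ∈ univ.filter (fun i => Quotient.mk s i = c),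
          x i • (Pi.single (rep (Quotient.mk s i)) 1 : α → R) =
            x i • (Pi.single (rep c) 1 : α → R) := by
        intro i hi
        rw [(mem_filter.1 hi).2]
      rw [sum_congr rfl h, ← sum_smul]
      have h0 := congrFun (LinearMap.mem_ker.1 hx) c
      rw [fiberSum_apply] at h0
      convert zero_smul R _
      rw [Pi.zero_apply] at h0
      convert h0
    have hx' : x = ∑ i, x i • (Pi.single i 1 - Pi.single (rep (Quotient.mk s i)) 1 : α → R) := by
      simp only [smul_sub, sum_sub_distrib]
      rw [hzero, sub_zero]
      exact pi_eq_sum_univ' x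
    rw [hx']
    refine S.sum_mem fun i _ => S.smul_mem _ (key _ _ ?_)
    exact Quotient.exact (Quotient.out_eq (Quotient.mk s i)).symm

end FiberSum

/-! ### Rank and multiplicity of a set of type A roots -/

section TypeA

variable {n : ℕ}

/-- The partition of `Fin n` into the connected components of the graph with edge set `B`. -/
def components (B : Finset {p : Fin n × Fin n // p.1 < p.2}) : Setoid (Fin n) :=
  Relation.EqvGen.setoid fun i j => ∃ p ∈ B, p.1 = (i, j)

instance (B : Finset {p : Fin n × Fin n // p.1 < p.2}) : Fintype (Quotient (components B)) :=
  Fintype.ofFinite _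

/-- The map sending a vertex to its connected component in the graph with edge set `B`. -/
abbrev toComponent (B : Finset {p : Fin n × Fin n // p.1 < p.2}) :
    Fin n → Quotient (components B) :=
  Quotient.mk (components B)

theorem toComponent_surjective (B : Finset {p : Fin n × Fin n // p.1 < p.2}) :
    Function.Surjective (toComponent B) := Quotient.mk_surjective

theorem image_positiveRootsA (B : Finset {p : Fin n × Fin n // p.1 < p.2}) :
    positiveRootsA n '' B = (Submodule.mkQ (Submodule.span ℝ {(1 : Fin n → ℝ)})) ''
      {v | ∃ i j, (∃ p ∈ B, p.1 = (i, j)) ∧ v = Pi.single i 1 - Pi.single j 1} := by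
  ext v
  constructor
  · rintro ⟨p, hp, rfl⟩
    exact ⟨_, ⟨p.1.1, p.1.2, ⟨p, hp, rfl⟩, rfl⟩, rfl⟩
  · rintro ⟨_, ⟨i, j, ⟨p, hp, h⟩, rfl⟩, rfl⟩
    refine ⟨p, hp, ?_⟩
    simp only [positiveRootsA, h]
    rfl

theorem span_image_positiveRootsA (B : Finset {p : Fin n × Fin n // p.1 < p.2}) :
    Submodule.span ℝ (positiveRootsA n '' B) =
      (LinearMap.ker (fiberSum ℝ (toComponent B))).map
        (Submodule.mkQ (Submodule.span ℝ {(1 : Fin n → ℝ)})) := by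
  rw [image_positiveRootsA, Submodule.span_image, span_single_sub_single_eq_ker]
  rfl

theorem mem_span_one {x : Fin n → ℝ} :
    x ∈ Submodule.span ℝ {(1 : Fin n → ℝ)} ↔ ∃ a : ℝ, x = fun _ => a := by
  rw [Submodule.mem_span_singleton]
  refine exists_congr fun a => ?_
  rw [eq_comm]
  congr! 1
  ext; simp

/-- Passing to the quotient by the all-ones vector loses no dimension: a constant vector `a` has
fiber sums `a` times a positive size, so it lies in the kernel only if `a = 0`. -/
theorem rank_positiveRootsA_add_card (hn : 0 < n)
    (B : Finset {p : Fin n × Fin n // p.1 < p.2}) :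
    rank (positiveRootsA n) B + Fintype.card (Quotient (components B)) = n := by
  have h := finrank_ker_fiberSum (toComponent_surjective B)
  rw [Fintype.card_fin] at h
  rw [rank, span_image_positiveRootsA, ← LinearMap.range_domRestrict,
    LinearMap.finrank_range_of_inj, h]
  rw [← LinearMap.ker_eq_bot, LinearMap.ker_eq_bot']
  rintro ⟨x, hx⟩ h0
  rw [LinearMap.domRestrict_apply, Submodule.mkQ_apply, Submodule.Quotient.mk_eq_zero,
    mem_span_one] at h0
  obtain ⟨a, rfl⟩ := h0
  have h1 := congrFun (LinearMap.mem_ker.1 hx) (toComponent B ⟨0, hn⟩)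
  rw [fiberSum_const, Pi.zero_apply, mul_eq_zero, Nat.cast_eq_zero] at h1
  have := fiberCard_pos (toComponent_surjective B) (toComponent B ⟨0, hn⟩)
  have ha : a = 0 := by rcases h1 with h1 | h1 <;> [exact h1; omega]
  subst ha
  rfl

/-- The projection from integer vectors to `TypeASpace n`. -/
def intProj (n : ℕ) : (Fin n → ℤ) →ₗ[ℤ] TypeASpace n :=
  (Submodule.mkQ (Submodule.span ℝ {(1 : Fin n → ℝ)})).toAddMonoidHom.toIntLinearMap ∘ₗ
    (Int.castAddHom ℝ).toIntLinearMap.compLeft (Fin n)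

theorem intProj_apply (z : Fin n → ℤ) :
    intProj n z = Submodule.mkQ (Submodule.span ℝ {(1 : Fin n → ℝ)}) (fun i => (z i : ℝ)) := rfl

theorem intProj_single (i : Fin n) : intProj n (Pi.single i 1) = basisVec n i := by
  rw [intProj_apply, basisVec, Submodule.mkQ_apply]
  congr 1
  ext j
  by_cases h : j = i
  · subst h; simp
  · simp [h]

theorem weightLatticeA_eq_range :
    weightLatticeA n = (LinearMap.range (intProj n)).toAddSubgroup := by
  have : (LinearMap.range (intProj n)) = Submodule.span ℤ (Set.range (basisVec n)) := by
    rw [← Submodule.map_top, ← (Pi.basisFun ℤ (Fin n)).span_eq, Submodule.map_span,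
      ← Set.range_comp]
    congr 2
    ext i
    simp [intProj_single]
  rw [this, Submodule.span_int_eq_addSubgroupClosure]
  rfl

theorem intProj_one : intProj n 1 = 0 := by
  rw [intProj_apply, Submodule.mkQ_apply, Submodule.Quotient.mk_eq_zero, mem_span_one]
  exact ⟨1, by ext; simp⟩

/-- Only this bound is needed: since `r = n - 1`, it already makes the truncated exponent `d - r`
zero. -/
theorem finrank_weightLatticeA_lt (hn : 0 < n) : Module.finrank ℤ (weightLatticeA n) < n := by
  have h := (LinearMap.ker (intProj n)).finrank_quotient_add_finrank
  rw [(intProj n).quotKerEquivRange.finrank_eq, Module.finrank_pi, Fintype.card_fin] at h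
  have h1 : 0 < Module.finrank ℤ (LinearMap.ker (intProj n)) := by
    rw [Module.finrank_pos_iff]
    refine ⟨⟨⟨1, intProj_one⟩, 0, fun h => ?_⟩⟩
    have := congrFun (congrArg Subtype.val h) ⟨0, hn⟩
    simp at this
  rw [weightLatticeA_eq_range]
  change Module.finrank ℤ (LinearMap.range (intProj n)) < n
  omega

/-- Subtracting a constant `a` lowers each fiber sum by `a` times the fiber size, so some lift lies
in the kernel exactly when the fiber sums are proportional to the sizes. -/
theorem intProj_mem_span_iff (B : Finset {p : Fin n × Fin n // p.1 < p.2}) (z : Fin n → ℤ) :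
    intProj n z ∈ Submodule.span ℝ (positiveRootsA n '' B) ↔
      ∃ a : ℝ, ∀ c, (fiberSum ℤ (toComponent B) z c : ℝ) = a * fiberCard (toComponent B) c := by
  have hcast : ∀ c, (fiberSum ℤ (toComponent B) z c : ℝ) =
      fiberSum ℝ (toComponent B) (fun i => (z i : ℝ)) c := by
    intro c; simp [fiberSum_apply]
  simp only [hcast]
  rw [span_image_positiveRootsA, intProj_apply]
  constructor
  · rintro ⟨x, hx, h⟩
    rw [Submodule.mkQ_apply, Submodule.mkQ_apply, eq_comm, Submodule.Quotient.eq, mem_span_one] at h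
    obtain ⟨a, ha⟩ := h
    refine ⟨a, fun c => ?_⟩
    rw [← fiberSum_const, ← ha, map_sub, LinearMap.mem_ker.1 hx, sub_zero]
  · rintro ⟨a, ha⟩
    refine ⟨(fun i => (z i : ℝ)) - fun _ => a, ?_, ?_⟩
    · rw [SetLike.mem_coe, LinearMap.mem_ker]
      ext c
      rw [map_sub, Pi.sub_apply, fiberSum_const, ha, sub_self]
      rfl
    · rw [Submodule.mkQ_apply, Submodule.mkQ_apply, eq_comm, Submodule.Quotient.eq, mem_span_one]
      exact ⟨a, by simp⟩

theorem intProj_eq_zero_iff (hn : 0 < n) (z : Fin n → ℤ) :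
    intProj n z = 0 ↔ ∃ m : ℤ, z = fun _ => m := by
  rw [intProj_apply, Submodule.mkQ_apply, Submodule.Quotient.mk_eq_zero, mem_span_one]
  constructor
  · rintro ⟨a, ha⟩
    refine ⟨z ⟨0, hn⟩, ?_⟩
    ext i
    have h1 := congrFun ha i
    have h2 := congrFun ha ⟨0, hn⟩
    exact_mod_cast h1.trans h2.symm
  · rintro ⟨m, rfl⟩
    exact ⟨m, rfl⟩

theorem closure_image_positiveRootsA (B : Finset {p : Fin n × Fin n // p.1 < p.2}) :
    AddSubgroup.closure (positiveRootsA n '' B) =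
      ((LinearMap.ker (fiberSum ℤ (toComponent B))).map (intProj n)).toAddSubgroup := by
  rw [← Submodule.span_int_eq_addSubgroupClosure]
  congr 1
  have h := span_single_sub_single_eq_ker (R := ℤ) (fun i j => ∃ p ∈ B, p.1 = (i, j))
  change _ = LinearMap.ker (fiberSum ℤ (toComponent B)) at h
  rw [← h, Submodule.map_span]
  congr 1
  ext v
  constructor
  · rintro ⟨p, hp, rfl⟩
    exact ⟨_, ⟨p.1.1, p.1.2, ⟨p, hp, rfl⟩, rfl⟩, by
      rw [map_sub, intProj_single, intProj_single]; rfl⟩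
  · rintro ⟨_, ⟨i, j, ⟨p, hp, h⟩, rfl⟩, rfl⟩
    refine ⟨p, hp, ?_⟩
    rw [map_sub, intProj_single, intProj_single, positiveRootsA, h]

/-- The argument for the real span, now with an integral factor. The index to be computed compares
real factors with integral ones. -/
theorem intProj_mem_closure_iff (hn : 0 < n) (B : Finset {p : Fin n × Fin n // p.1 < p.2})
    (z : Fin n → ℤ) :
    intProj n z ∈ AddSubgroup.closure (positiveRootsA n '' B) ↔
      ∃ m : ℤ, ∀ c, fiberSum ℤ (toComponent B) z c = m * fiberCard (toComponent B) c := by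
  rw [closure_image_positiveRootsA]
  constructor
  · rintro ⟨w, hw, h⟩
    have h0 : intProj n (z - w) = 0 := by rw [map_sub, h, sub_self]
    obtain ⟨m, hm⟩ := (intProj_eq_zero_iff hn _).1 h0
    refine ⟨m, fun c => ?_⟩
    rw [← fiberSum_const, ← hm, map_sub, LinearMap.mem_ker.1 hw, sub_zero]
  · rintro ⟨m, hm⟩
    refine ⟨z - fun _ => m, ?_, ?_⟩
    · rw [SetLike.mem_coe, LinearMap.mem_ker]
      ext c
      rw [map_sub, Pi.sub_apply, fiberSum_const, hm, sub_self]
      rfl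
    · rw [map_sub, (intProj_eq_zero_iff hn (fun _ => m)).2 ⟨m, rfl⟩, sub_zero]

/-- The index of a sublattice generated by positive roots in its saturation within the weight
lattice is the greatest common divisor of the sizes of the connected components. -/
theorem latticeMultiplicity_positiveRootsA (hn : 0 < n)
    (B : Finset {p : Fin n × Fin n // p.1 < p.2}) :
    latticeMultiplicity (weightLatticeA n) (positiveRootsA n) B = fiberGcd (toComponent B) := by
  set k := fiberCard (toComponent B) with hk
  set g := fiberGcd (toComponent B) with hg
  have hsum := sum_fiberCard (toComponent B)
  rw [Fintype.card_fin] at hsum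
  have hsum_cast : ∀ (R : Type) [CommRing R], ∑ c, (k c : R) = n := by
    intro R _
    rw [← Nat.cast_sum, hk, hsum]
  obtain ⟨b, hb⟩ : g ∣ n := by simpa using fiberGcd_dvd_card (toComponent B)
  have hgpos : 0 < g := Nat.pos_of_ne_zero (by rintro h; simp [h] at hb; omega)
  have hbpos : 0 < b := Nat.pos_of_ne_zero (by rintro h; simp [h] at hb; omega)
  let H : AddSubgroup (Fin n → ℤ) :=
    (Submodule.span ℝ (positiveRootsA n '' B)).toAddSubgroup.comap (intProj n).toAddMonoidHom
  -- If the fiber sums are `a` times the sizes, the coordinate sum is `a * n`. It thus determines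
  -- the factor `a`, and `a` is an integer exactly when `n` divides it.
  let total : (Fin n → ℤ) →+ ℤ := ∑ i, Pi.evalAddMonoidHom (fun _ => ℤ) i
  have htotal : ∀ z, total z = ∑ c, fiberSum ℤ (toComponent B) z c := by
    intro z; rw [sum_fiberSum]; simp [total]
  have hH : (Submodule.span ℝ (positiveRootsA n '' B)).toAddSubgroup ⊓ weightLatticeA n =
      H.map (intProj n).toAddMonoidHom := by
    rw [AddSubgroup.map_comap_eq, inf_comm, weightLatticeA_eq_range]
    rfl
  rw [latticeMultiplicity, hH, ← AddSubgroup.relIndex_comap]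
  have hreal : ∀ z a, (∀ c, (fiberSum ℤ (toComponent B) z c : ℝ) = a * k c) →
      (total z : ℝ) = a * n := by
    intro z a ha
    rw [htotal]
    push_cast
    rw [sum_congr rfl fun c _ => ha c, ← mul_sum, hsum_cast]
  have hK : ((AddSubgroup.closure (positiveRootsA n '' B)).comap
      (intProj n).toAddMonoidHom).relIndex H =
      ((AddSubgroup.zmultiples (n : ℤ)).comap total).relIndex H := by
    rw [← AddSubgroup.inf_relIndex_right, ← AddSubgroup.inf_relIndex_right (AddSubgroup.comap total _)]
    congr 1
    ext z
    simp only [AddSubgroup.mem_inf, and_congr_left_iff]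
    intro hz
    obtain ⟨a, ha⟩ := (intProj_mem_span_iff B z).1 hz
    have hta := hreal z a ha
    rw [AddSubgroup.mem_comap, AddSubgroup.mem_comap, Int.mem_zmultiples_iff]
    refine (intProj_mem_closure_iff hn B z).trans ?_
    constructor
    · rintro ⟨m, hm⟩
      refine ⟨m, ?_⟩
      rw [htotal, sum_congr rfl fun c _ => hm c, ← mul_sum, hsum_cast, mul_comm]
    · rintro ⟨m, hm⟩
      refine ⟨m, fun c => ?_⟩
      have ham : a = m := by
        rw [hm] at hta
        push_cast at hta
        have : (n : ℝ) ≠ 0 := by positivity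
        field_simp at hta
        linarith
      have := ha c
      rw [ham] at this
      exact_mod_cast this
  rw [hK, AddSubgroup.relIndex_comap]
  -- The possible factors are the multiples of `1 / g`: Bézout makes `a * g` an integer, and
  -- conversely the fiber sums `m * l c`, with `l c` the size divided by `g`, realize `a = m / g`.
  -- Hence the totals are the multiples of `b = n / g`.
  have himg : H.map total = AddSubgroup.zmultiples (b : ℤ) := by
    ext t
    rw [Int.mem_zmultiples_iff]
    constructor
    · rintro ⟨z, hz, rfl⟩
      obtain ⟨a, ha⟩ := (intProj_mem_span_iff B z).1 hz
      have hta := hreal z a ha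
      obtain ⟨u, hu⟩ := exists_sum_mul_eq_fiberGcd (toComponent B)
      refine ⟨∑ c, u c * fiberSum ℤ (toComponent B) z c, ?_⟩
      have hug : ((∑ c, u c * fiberSum ℤ (toComponent B) z c : ℤ) : ℝ) = a * g := by
        have hu' : (∑ c, (u c : ℝ) * k c) = g := by exact_mod_cast hu
        push_cast
        rw [← hu', mul_sum]
        refine sum_congr rfl fun c _ => ?_
        rw [ha]; ring
      have : (total z : ℝ) = b * ((∑ c, u c * fiberSum ℤ (toComponent B) z c : ℤ) : ℝ) := by
        rw [hug, hta, hb]; push_cast; ring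
      exact_mod_cast this
    · rintro ⟨m, rfl⟩
      choose l hl using fiberGcd_dvd (toComponent B)
      obtain ⟨z, hz⟩ := fiberSum_surjective (R := ℤ) (toComponent_surjective B)
        (fun c => m * l c)
      refine ⟨z, (intProj_mem_span_iff B z).2 ⟨m / g, fun c => ?_⟩, ?_⟩
      · rw [hz, hl c]
        have : (g : ℝ) ≠ 0 := by positivity
        push_cast
        field_simp
        rfl
      · change total z = _
        rw [htotal, hz, ← mul_sum, mul_comm]
        congr 1
        have : g * b = g * ∑ c, l c := by
          rw [← hb, mul_sum]
          exact hsum.symm.trans (sum_congr rfl fun c _ => hl c)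
        exact_mod_cast (Nat.eq_of_mul_eq_mul_left hgpos this).symm
  -- Dividing by `b` reduces the index of `nℤ` in `bℤ` to that of `gℤ` in `ℤ`.
  have h1 : AddSubgroup.zmultiples (b : ℤ) = (⊤ : AddSubgroup ℤ).map (AddMonoidHom.mulLeft (b : ℤ)) := by
    rw [← Int.zmultiples_one, AddMonoidHom.map_zmultiples]
    simp
  have h2 : AddSubgroup.zmultiples (n : ℤ) =
      (AddSubgroup.zmultiples (g : ℤ)).map (AddMonoidHom.mulLeft (b : ℤ)) := by
    rw [AddMonoidHom.map_zmultiples]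
    have : (n : ℤ) = b * g := by rw [hb]; push_cast; ring
    rw [this]
    rfl
  have hinj : Function.Injective (AddMonoidHom.mulLeft (b : ℤ)) := fun x y h =>
    mul_left_cancel₀ (by exact_mod_cast hbpos.ne') h
  rw [himg, h1, h2, AddSubgroup.relIndex_map_map_of_injective _ _ hinj,
    AddSubgroup.relIndex_top_right, Int.index_zmultiples, Int.natAbs_natCast]

end TypeA

/-! ### The characteristic polynomial as a signed sum over graphs -/

section CharPoly

variable {n : ℕ}

theorem card_components_pos (hn : 0 < n) (B : Finset {p : Fin n × Fin n // p.1 < p.2}) :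
    0 < Fintype.card (Quotient (components B)) :=
  Fintype.card_pos_iff.2 ⟨toComponent B ⟨0, hn⟩⟩

theorem card_components_univ (hn : 0 < n) :
    Fintype.card (Quotient (components (univ : Finset {p : Fin n × Fin n // p.1 < p.2}))) = 1 := by
  rw [Fintype.card_eq_one_iff]
  refine ⟨toComponent univ ⟨0, hn⟩, ?_⟩
  rintro ⟨i⟩
  by_cases h : i = ⟨0, hn⟩
  · rw [h]; rfl
  · have hlt : (⟨0, hn⟩ : Fin n) < i := by
      rw [Fin.lt_def]
      exact Nat.pos_of_ne_zero fun h0 => h (Fin.ext h0)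
    exact Quotient.sound (Relation.EqvGen.symm _ _
      (Relation.EqvGen.rel _ _ ⟨⟨(⟨0, hn⟩, i), hlt⟩, mem_univ _, rfl⟩))

theorem rank_le_card {V ι : Type*} [AddCommGroup V] [Module ℝ V] (A : ι → V) (B : Finset ι) :
    rank A B ≤ B.card := by
  classical
  rw [rank, ← coe_image]
  exact (finrank_span_finset_le_card _).trans card_image_le

/-- At `x = 1 - q`, `y = 0` the two bases are `-q` and `-1`. As `r(A) - r(B) = c - 1`, all signs
combine to `(-1)^|B|`. -/
theorem eval_charPolyWeightA (hn : 0 < n) (q : ℤ) :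
    (charPolyWeightA n).eval q =
      ∑ B : Finset {p : Fin n × Fin n // p.1 < p.2}, (-1) ^ B.card *
        (fiberGcd (toComponent B) * q ^ (Fintype.card (Quotient (components B)) - 1) : ℤ) := by
  have hr := rank_positiveRootsA_add_card hn univ
  rw [card_components_univ hn] at hr
  have hd := finrank_weightLatticeA_lt hn
  have hd0 : Module.finrank ℤ (weightLatticeA n) - rank (positiveRootsA n) univ = 0 := by omega
  rw [charPolyWeightA, arithmeticCharPoly, arithmeticTutte, hd0]
  simp only [map_sum, map_mul, map_pow, map_sub, map_one, MvPolynomial.aeval_X,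
    MvPolynomial.aeval_C, latticeMultiplicity_positiveRootsA hn, eval_mul, eval_finsetSum,
    eval_pow, eval_neg, eval_one, pow_zero, mul_one, mul_sum]
  refine sum_congr rfl fun B _ => ?_
  have hB := rank_positiveRootsA_add_card hn B
  have hB' := rank_le_card (positiveRootsA n) B
  have hc := card_components_pos hn B
  have e1 : rank (positiveRootsA n) univ - rank (positiveRootsA n) B =
      Fintype.card (Quotient (components B)) - 1 := by omega
  rw [e1]
  simp only [Matrix.cons_val_zero, Matrix.cons_val_one, eval_sub, eval_one, eval_X, eval_zero,
    eq_intCast, Int.cast_natCast, eval_natCast]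
  have e2 : (1 - q - 1 : ℤ) = (-1) * q := by ring
  have e3 : (0 - 1 : ℤ) = -1 := by ring
  rw [e2, e3, mul_pow]
  have e4 : (-1 : ℤ) ^ rank (positiveRootsA n) univ *
      ((-1) ^ (Fintype.card (Quotient (components B)) - 1) *
        (-1) ^ (B.card - rank (positiveRootsA n) B)) = (-1) ^ B.card := by
    rw [← pow_add, ← pow_add]
    have : rank (positiveRootsA n) univ + (Fintype.card (Quotient (components B)) - 1 +
      (B.card - rank (positiveRootsA n) B)) =
        B.card + 2 * (Fintype.card (Quotient (components B)) - 1) := by omega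
    rw [this, pow_add, pow_mul]
    simp
  rw [← e4]
  ring

end CharPoly

/-! ### From the characteristic polynomial to zero-sum subsets -/

section Counting

variable {q : ℕ} [NeZero q]

/-- The solutions form the kernel of a homomorphism to `ZMod q`, whose image is generated by `g` by
Bézout and has `q / g` elements because `g ∣ q`. -/
theorem card_weighted_sum_eq_zero {α β : Type*} [Fintype β] [Nonempty β] (f : α → β)
    (hq : fiberGcd f ∣ q) :
    Nat.card {y : β → ZMod q // ∑ c, y c * (fiberCard f c : ZMod q) = 0} =
      fiberGcd f * q ^ (Fintype.card β - 1) := by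
  let φ : (β → ZMod q) →+ ZMod q :=
    { toFun := fun y => ∑ c, y c * (fiberCard f c : ZMod q)
      map_zero' := by simp
      map_add' := by intro x y; simp [add_mul, sum_add_distrib] }
  obtain ⟨m, hm⟩ := hq
  have hq0 : 0 < q := NeZero.pos q
  have hg0 : 0 < fiberGcd f := Nat.pos_of_ne_zero (by rintro h; simp [h] at hm; omega)
  have hm0 : 0 < m := Nat.pos_of_ne_zero (by rintro h; simp [h] at hm; omega)
  have hrange : φ.range = AddSubgroup.zmultiples (fiberGcd f : ZMod q) := by
    apply le_antisymm
    · rintro _ ⟨y, rfl⟩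
      refine AddSubgroup.sum_mem _ fun c _ => ?_
      obtain ⟨l, hl⟩ := fiberGcd_dvd f c
      rw [hl, AddSubgroup.mem_zmultiples_iff]
      refine ⟨((y c * l).val : ℤ), ?_⟩
      rw [natCast_zsmul, nsmul_eq_mul, ZMod.natCast_zmod_val]
      push_cast
      ring
    · rw [AddSubgroup.zmultiples_le]
      obtain ⟨a, ha⟩ := exists_sum_mul_eq_fiberGcd f
      refine ⟨fun c => (a c : ZMod q), ?_⟩
      have ha' := congrArg (Int.cast : ℤ → ZMod q) ha
      push_cast at ha'
      exact ha'
  have h := φ.ker.card_mul_index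
  rw [AddSubgroup.index_ker, hrange, Nat.card_zmultiples, ZMod.addOrderOf_coe _ hq0.ne',
    Nat.gcd_eq_right ⟨m, hm⟩, Nat.card_fun, Nat.card_zmod, Nat.card_eq_fintype_card (α := β)] at h
  have hqm : q / fiberGcd f = m := Nat.div_eq_of_eq_mul_right hg0 hm
  rw [hqm] at h
  have hc : 0 < Fintype.card β := Fintype.card_pos
  have hpow : q ^ Fintype.card β = fiberGcd f * q ^ (Fintype.card β - 1) * m := by
    obtain ⟨k, hk⟩ : ∃ k, Fintype.card β = k + 1 := ⟨_, (Nat.sub_add_cancel hc).symm⟩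
    rw [hk, pow_succ, Nat.add_sub_cancel, mul_right_comm, ← hm, mul_comm]
  rw [hpow] at h
  exact Nat.eq_of_mul_eq_mul_right hm0 h

theorem sum_comp_eq_sum_mul_fiberCard {α β R : Type*} [Fintype α] [Fintype β] [CommRing R]
    (f : α → β) (y : β → R) : ∑ i, y (f i) = ∑ c, y c * (fiberCard f c : R) := by
  classical
  rw [← sum_fiberwise univ f]
  refine sum_congr rfl fun c _ => ?_
  rw [sum_congr rfl fun i hi => by rw [(mem_filter.1 hi).2], sum_const, fiberCard_eq,
    nsmul_eq_mul, mul_comm]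

variable {n : ℕ}

theorem eq_of_components {X : Type*} {B : Finset {p : Fin n × Fin n // p.1 < p.2}} {x : Fin n → X}
    (hx : ∀ p ∈ B, x p.1.1 = x p.1.2) {i j : Fin n} (h : components B i j) : x i = x j := by
  induction h with
  | rel i j h => obtain ⟨p, hp, h⟩ := h; simpa [h] using hx p hp
  | refl i => rfl
  | symm i j _ ih => exact ih.symm
  | trans i j k _ _ h1 h2 => exact h1.trans h2

/-- A tuple constant along edges is a function on components, with each component weighted by its
size in the sum. The hypothesis `n ∣ q` gives `g ∣ q`. -/
theorem card_sum_eq_zero_of_constant (hn : 0 < n) (hq : n ∣ q)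
    (B : Finset {p : Fin n × Fin n // p.1 < p.2}) :
    #{x : Fin n → ZMod q | ∑ i, x i = 0 ∧ ∀ p ∈ B, x p.1.1 = x p.1.2} =
      fiberGcd (toComponent B) * q ^ (Fintype.card (Quotient (components B)) - 1) := by
  have : Nonempty (Quotient (components B)) := ⟨toComponent B ⟨0, hn⟩⟩
  have hg : fiberGcd (toComponent B) ∣ q :=
    (by simpa using fiberGcd_dvd_card (toComponent B) : fiberGcd (toComponent B) ∣ n).trans hq
  rw [← card_weighted_sum_eq_zero _ hg, ← Fintype.card_subtype, ← Nat.card_eq_fintype_card]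
  refine Nat.card_congr
    { toFun := fun x => ⟨Quotient.lift x.1 fun i j h => eq_of_components x.2.2 h, ?_⟩
      invFun := fun y => ⟨y.1 ∘ toComponent B, ?_, ?_⟩
      left_inv := fun x => rfl
      right_inv := fun y => Subtype.ext (funext fun c => Quotient.inductionOn c fun i => rfl) }
  · rw [← sum_comp_eq_sum_mul_fiberCard]
    exact x.2.1
  · exact (sum_comp_eq_sum_mul_fiberCard (toComponent B) y.1).trans y.2
  · intro p hp
    exact congrArg y.1 (Quotient.sound (Relation.EqvGen.rel _ _ ⟨p, hp, rfl⟩))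

theorem injective_iff_forall_lt_ne {X : Type*} (x : Fin n → X) :
    Function.Injective x ↔ ∀ p : {p : Fin n × Fin n // p.1 < p.2}, x p.1.1 ≠ x p.1.2 := by
  constructor
  · intro h p hp
    exact p.2.ne (h hp)
  · intro h i j hij
    rcases lt_trichotomy i j with hlt | heq | hlt
    · exact (h ⟨(i, j), hlt⟩ hij).elim
    · exact heq
    · exact (h ⟨(j, i), hlt⟩ hij.symm).elim

/-- Inclusion-exclusion for injective functions over the sets of coinciding pairs. -/
theorem sum_neg_one_pow_mul_card_constant {X : Type*} [Fintype X] [DecidableEq X]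
    (P : (Fin n → X) → Prop) [DecidablePred P] :
    ∑ B : Finset {p : Fin n × Fin n // p.1 < p.2},
        (-1 : ℤ) ^ B.card * #{x : Fin n → X | P x ∧ ∀ p ∈ B, x p.1.1 = x p.1.2} =
      #{x : Fin n → X | P x ∧ Function.Injective x} := by
  classical
  simp only [← filter_filter, card_filter (fun x : Fin n → X => Function.Injective x),
    card_filter (fun x : Fin n → X => ∀ p ∈ _, _), Nat.cast_sum, mul_sum]
  rw [sum_comm]
  refine sum_congr rfl fun x _ => ?_
  -- For fixed `x`, the alternating sum over `B` is the expansion of the product of `1 - [x i = x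
  -- j]` over all pairs.
  have h : ∏ p : {p : Fin n × Fin n // p.1 < p.2},
      (1 + (-1) * (if x p.1.1 = x p.1.2 then (1 : ℤ) else 0)) =
        if Function.Injective x then 1 else 0 := by
    rw [prod_congr rfl (g := fun p : {p : Fin n × Fin n // p.1 < p.2} =>
      if x p.1.1 ≠ x p.1.2 then (1 : ℤ) else 0) fun p _ => by split_ifs <;> simp_all]
    rw [prod_ite_zero, prod_const_one]
    simp [injective_iff_forall_lt_ne]
  push_cast
  rw [← h, prod_one_add, powerset_univ]
  refine sum_congr rfl fun B _ => ?_
  rw [prod_mul_distrib, prod_const, prod_ite_zero, prod_const_one]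
  congr

/-- The injections with image `S` are the `n!` bijections `Fin n ≃ S`. -/
theorem card_injective_filter_image {X : Type*} [Fintype X] [DecidableEq X]
    (P : Finset X → Prop) [DecidablePred P] :
    #{x : Fin n → X | P (univ.image x) ∧ Function.Injective x} =
      n.factorial * #{S ∈ powersetCard n (univ : Finset X) | P S} := by
  classical
  rw [card_eq_sum_card_fiberwise (f := fun x => univ.image x)
    (t := {S ∈ powersetCard n (univ : Finset X) | P S})]
  · rw [sum_const_nat (m := n.factorial), mul_comm]
    intro S hS
    simp only [mem_filter, mem_powersetCard, subset_univ, true_and] at hS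
    have e : Fin n ≃ S := Fintype.equivOfCardEq (by simp [hS.1])
    have hcard := Fintype.card_equiv e
    rw [Fintype.card_fin] at hcard
    rw [← hcard, filter_filter, ← Fintype.card_subtype]
    have himg : ∀ x : Fin n → X, univ.image x = S → ∀ i, x i ∈ S := by
      rintro x rfl i
      exact mem_image_of_mem _ (mem_univ i)
    refine Fintype.card_congr
      { toFun := fun x => Equiv.ofBijective
          (fun i => (⟨x.1 i, himg x.1 x.2.2 i⟩ : S)) ⟨?_, ?_⟩
        invFun := fun e => ⟨fun i => e i, ?_⟩
        left_inv := fun x => rfl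
        right_inv := fun e => by ext; rfl }
    · intro i j h
      exact x.2.1.2 (congrArg Subtype.val h)
    · rintro ⟨s, hs⟩
      have := hs
      rw [← x.2.2, mem_image] at this
      obtain ⟨i, _, hi⟩ := this
      exact ⟨i, Subtype.ext hi⟩
    · have hS' : univ.image (fun i => (e i : X)) = S := by
        ext s
        simp only [mem_image, mem_univ, true_and]
        constructor
        · rintro ⟨i, rfl⟩; exact (e i).2
        · intro hs; exact ⟨e.symm ⟨s, hs⟩, by simp⟩
      refine ⟨⟨?_, ?_⟩, hS'⟩
      · rw [hS']; exact hS.2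
      · exact Subtype.val_injective.comp e.injective
  · intro x hx
    simp only [coe_filter, mem_univ, true_and, Set.mem_ofPred_eq, mem_powersetCard,
      subset_univ] at hx ⊢
    exact ⟨by rw [card_image_of_injective _ hx.2, card_univ, Fintype.card_fin], hx.1⟩

/-- The characteristic polynomial counts subsets of `ZMod q` with vanishing sum. -/
theorem eval_charPolyWeightA_eq_card (hn : 0 < n) (hq : n ∣ q) :
    (charPolyWeightA n).eval (q : ℤ) =
      n.factorial * #{S ∈ powersetCard n (univ : Finset (ZMod q)) | ∑ x ∈ S, x = 0} := by
  rw [eval_charPolyWeightA hn]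
  have h := sum_neg_one_pow_mul_card_constant (n := n) (X := ZMod q) fun x => ∑ i, x i = 0
  simp only [card_sum_eq_zero_of_constant hn hq] at h
  push_cast at h
  rw [h]
  have h' := card_injective_filter_image (n := n) (X := ZMod q) fun S => ∑ x ∈ S, x = 0
  rw [← Nat.cast_mul, ← h']
  congr 2
  ext x
  simp only [mem_filter, mem_univ, true_and, and_congr_left_iff]
  intro hx
  rw [sum_image hx.injOn]

end Counting

/-! ### Counting zero-sum subsets with additive characters -/

section RootsOfUnity

theorem _root_.IsPrimitiveRoot.prod_range_sub_pow_mul {R : Type*} [CommRing R] [IsDomain R]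
    {ζ : R} {d : ℕ}
    (hd : 0 < d) (hζ : IsPrimitiveRoot ζ d) (x y : R) :
    ∏ k ∈ range d, (x - ζ ^ k * y) = x ^ d - y ^ d := by
  rw [hζ.pow_sub_pow_eq_prod_sub_mul x y hd]
  refine prod_nbij (fun k => ζ ^ k) ?_ ?_ ?_ fun _ _ => rfl
  · intro k _
    rw [mem_nthRootsFinset hd, ← pow_mul, mul_comm, pow_mul, hζ.pow_eq_one, one_pow]
  · intro k hk l hl h
    exact hζ.pow_inj (mem_range.1 hk) (mem_range.1 hl) h
  · intro z hz
    have : NeZero d := ⟨hd.ne'⟩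
    obtain ⟨k, hk, h⟩ := hζ.eq_pow_of_pow_eq_one ((mem_nthRootsFinset hd _).1 hz)
    exact ⟨k, mem_coe.2 (mem_range.2 hk), h⟩

theorem prod_range_mul_of_periodic {M : Type*} [CommMonoid M] {d : ℕ} (F : ℕ → M)
    (hF : Function.Periodic F d) (m : ℕ) :
    ∏ k ∈ range (d * m), F k = (∏ k ∈ range d, F k) ^ m := by
  induction m with
  | zero => simp
  | succ m ih =>
    rw [mul_add_one, prod_range_add, ih, pow_succ]
    congr 1
    refine prod_congr rfl fun k _ => ?_
    rw [add_comm, mul_comm]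
    exact hF.nat_mul m k

variable {q : ℕ} [NeZero q]

theorem addChar_sum_eq_prod {A M ι : Type*} [AddCommMonoid A] [CommMonoid M] (ψ : AddChar A M)
    (s : Finset ι) (f : ι → A) : ψ (∑ i ∈ s, f i) = ∏ i ∈ s, ψ (f i) := by
  classical
  induction s using Finset.induction_on with
  | empty => simp
  | insert a s ha ih => rw [sum_insert ha, prod_insert ha, AddChar.map_add_eq_mul, ih]

theorem isPrimitiveRoot_stdAddChar (t : ZMod q) :
    IsPrimitiveRoot (ZMod.stdAddChar t) (addOrderOf t) where
  pow_eq_one := by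
    rw [← AddChar.map_nsmul_eq_pow, addOrderOf_nsmul_eq_zero, AddChar.map_zero_eq_one]
  dvd_of_pow_eq_one l hl := by
    rw [← AddChar.map_nsmul_eq_pow, ← AddChar.map_zero_eq_one (ZMod.stdAddChar (N := q))] at hl
    exact addOrderOf_dvd_of_nsmul_eq_zero (ZMod.injective_stdAddChar hl)

theorem prod_zmod_val {M : Type*} [CommMonoid M] (F : ℕ → M) :
    ∏ x : ZMod q, F x.val = ∏ k ∈ range q, F k := by
  obtain ⟨k, rfl⟩ := Nat.exists_eq_succ_of_ne_zero (NeZero.ne q)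
  exact Fin.prod_univ_eq_prod_range F (k + 1)

theorem addOrderOf_dvd_modulus (t : ZMod q) : addOrderOf t ∣ q := by
  simpa using addOrderOf_dvd_card (x := t)

/-- As `x` varies, the character value runs `q / d` times through the `d`-th roots of unity, and the
product of `1 - ζ^k y` over one period is `1 - y^d`; take `y = -X`. -/
theorem prod_one_add_stdAddChar_mul_X (t : ZMod q) :
    ∏ x : ZMod q, (1 + C (ZMod.stdAddChar (t * x)) * X : ℂ[X]) =
      (1 - (-X) ^ addOrderOf t) ^ (q / addOrderOf t) := by
  set d := addOrderOf t
  have hd : 0 < d := addOrderOf_pos t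
  have hζ := (isPrimitiveRoot_stdAddChar t).map_of_injective (C_injective (R := ℂ))
  set ζ : ℂ[X] := C (ZMod.stdAddChar t)
  have h1 : ∀ x : ZMod q, (1 + C (ZMod.stdAddChar (t * x)) * X : ℂ[X]) = 1 - ζ ^ x.val * (-X) := by
    intro x
    have : t * x = x.val • t := by rw [nsmul_eq_mul, ZMod.natCast_zmod_val, mul_comm]
    rw [this, AddChar.map_nsmul_eq_pow, C_pow]
    ring
  rw [prod_congr rfl fun x _ => h1 x, prod_zmod_val fun k => 1 - ζ ^ k * (-X)]
  have hq : q = d * (q / d) := (Nat.mul_div_cancel' (addOrderOf_dvd_modulus t)).symm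
  conv_lhs => rw [hq]
  rw [prod_range_mul_of_periodic, hζ.prod_range_sub_pow_mul hd, one_pow]
  intro k
  simp only [pow_add]
  rw [hζ.pow_eq_one, mul_one]

theorem coeff_prod_one_add_C_mul_X {R ι : Type*} [CommRing R] [Fintype ι] (f : ι → R) (n : ℕ) :
    (∏ x, (1 + C (f x) * X : R[X])).coeff n = ∑ S ∈ powersetCard n univ, ∏ x ∈ S, f x := by
  classical
  rw [prod_one_add, finsetSum_coeff, powersetCard_eq_filter, sum_filter]
  refine sum_congr rfl fun S _ => ?_
  rw [prod_mul_distrib, prod_const, ← map_prod, coeff_C_mul_X_pow]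
  simp only [eq_comm]

/-- Oddness of `n` removes the sign: `d ∣ n` forces `d` odd, so the base is `1 + X^d`. In every case
the polynomial is one in `X^d`, so the coefficient vanishes when `d ∤ n`. -/
theorem coeff_one_sub_neg_X_pow {R : Type*} [CommRing R] {n d : ℕ} (hn : Odd n) (hd : 0 < d)
    (m : ℕ) : ((1 - (-X) ^ d : R[X]) ^ m).coeff n =
      ((if d ∣ n then m.choose (n / d) else 0 : ℕ) : R) := by
  by_cases h : d ∣ n
  · have hodd : Odd d := hn.of_dvd_nat h
    have : (1 - (-X) ^ d : R[X]) ^ m = expand R d ((1 + X) ^ m) := by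
      rw [hodd.neg_pow]; simp
    rw [this, coeff_expand hd, if_pos h, if_pos h, coeff_one_add_X_pow]
  · have : (1 - (-X) ^ d : R[X]) ^ m = expand R d ((1 - (-1) ^ d * X) ^ m) := by
      rw [neg_pow]; simp
    rw [this, coeff_expand hd, if_neg h, if_neg h, Nat.cast_zero]

/-- The number of `n`-element subsets of `ZMod q` with vanishing sum, for `n` odd. -/
theorem modulus_mul_card_sum_eq_zero {n : ℕ} (hn : Odd n) :
    q * #{S ∈ powersetCard n (univ : Finset (ZMod q)) | ∑ x ∈ S, x = 0} =
      ∑ t : ZMod q, if addOrderOf t ∣ n then (q / addOrderOf t).choose (n / addOrderOf t) else 0 := by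
  have key : ∀ t : ZMod q,
      ((if addOrderOf t ∣ n then (q / addOrderOf t).choose (n / addOrderOf t) else 0 : ℕ) : ℂ) =
        ∑ S ∈ powersetCard n (univ : Finset (ZMod q)), ZMod.stdAddChar (t * ∑ x ∈ S, x) := by
    intro t
    rw [← coeff_one_sub_neg_X_pow hn (addOrderOf_pos t), ← prod_one_add_stdAddChar_mul_X,
      coeff_prod_one_add_C_mul_X]
    refine sum_congr rfl fun S _ => ?_
    rw [mul_sum, addChar_sum_eq_prod]
  have : ((q * #{S ∈ powersetCard n (univ : Finset (ZMod q)) | ∑ x ∈ S, x = 0} : ℕ) : ℂ) =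
      ((∑ t : ZMod q, if addOrderOf t ∣ n then
        (q / addOrderOf t).choose (n / addOrderOf t) else 0 : ℕ) : ℂ) := by
    -- After exchanging sums, orthogonality gives `q` for each `S` with zero sum and `0` otherwise.
    rw [Nat.cast_sum, sum_congr rfl fun t _ => key t, sum_comm,
      sum_congr rfl fun S _ => AddChar.sum_mulShift _ (ZMod.isPrimitive_stdAddChar q)]
    rw [ZMod.card, card_filter]
    push_cast
    rw [mul_sum]
    simp
  exact_mod_cast this

end RootsOfUnity

open scoped Pointwise

/-! ### Translation orbits on subsets by Burnside's lemma -/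

section Burnside

variable {G : Type*} [AddCommGroup G] [Fintype G] [DecidableEq G]

open scoped Classical in
/-- The preimage in `G` of a subset of the quotient by the subgroup generated by `t`. -/
def preimageMk (t : G) (T : Finset (G ⧸ AddSubgroup.zmultiples t)) : Finset G :=
  {x | (x : G ⧸ AddSubgroup.zmultiples t) ∈ T}

omit [DecidableEq G] in
theorem mem_preimageMk {t : G} {T : Finset (G ⧸ AddSubgroup.zmultiples t)} {x : G} :
    x ∈ preimageMk t T ↔ (x : G ⧸ AddSubgroup.zmultiples t) ∈ T := by
  simp [preimageMk]

omit [DecidableEq G] in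
theorem card_preimageMk (t : G) (T : Finset (G ⧸ AddSubgroup.zmultiples t)) :
    #(preimageMk t T) = addOrderOf t * #T := by
  have h := Nat.card_congr (QuotientAddGroup.preimageMkEquivAddSubgroupProdSet
    (AddSubgroup.zmultiples t) (T : Set (G ⧸ AddSubgroup.zmultiples t)))
  rw [Nat.card_prod, Nat.card_zmultiples, Nat.card_coe_set_eq, Nat.card_coe_set_eq,
    Set.ncard_coe_finset] at h
  rw [← h, ← Set.ncard_coe_finset]
  congr 1
  ext x
  simp [preimageMk]

theorem vadd_preimageMk (t : G) (T : Finset (G ⧸ AddSubgroup.zmultiples t)) :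
    t +ᵥ preimageMk t T = preimageMk t T := by
  ext x
  rw [← neg_vadd_mem_iff, mem_preimageMk, mem_preimageMk]
  have : ((-t +ᵥ x : G) : G ⧸ AddSubgroup.zmultiples t) = x := by
    rw [QuotientAddGroup.eq]
    have : -(-t +ᵥ x) + x = t := by rw [vadd_eq_add]; abel
    rw [this]
    exact AddSubgroup.mem_zmultiples t
  rw [this]

/-- The stabilizer of `S` contains the subgroup generated by `t`, so `S` is a union of its cosets.
-/
theorem exists_preimageMk_eq {t : G} {S : Finset G} (h : t +ᵥ S = S) :
    ∃ T, preimageMk t T = S := by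
  classical
  refine ⟨S.image (fun x : G => (x : G ⧸ AddSubgroup.zmultiples t)), ?_⟩
  have hle : AddSubgroup.zmultiples t ≤ AddAction.stabilizer G S := by
    rw [AddSubgroup.zmultiples_le]
    exact h
  ext x
  rw [mem_preimageMk, mem_image]
  constructor
  · rintro ⟨y, hy, hyx⟩
    have h1 : (-y + x) +ᵥ S = S := hle (QuotientAddGroup.eq.1 hyx)
    rw [← h1]
    have := vadd_mem_vadd_finset (a := -y + x) hy
    rwa [vadd_eq_add, neg_add_cancel_comm] at this
  · intro hx
    exact ⟨x, hx, rfl⟩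

omit [DecidableEq G] in
theorem preimageMk_injective (t : G) : Function.Injective (preimageMk t) := by
  intro T T' h
  ext c
  obtain ⟨x, rfl⟩ := QuotientAddGroup.mk_surjective c
  rw [← mem_preimageMk, h, mem_preimageMk]

/-- The number of `n`-element subsets of `G` invariant under translation by `t`. -/
theorem card_filter_vadd_eq (t : G) (n : ℕ) :
    #{S ∈ powersetCard n (univ : Finset G) | t +ᵥ S = S} =
      if addOrderOf t ∣ n then
        (Fintype.card G / addOrderOf t).choose (n / addOrderOf t) else 0 := by
  classical
  set d := addOrderOf t
  have hd : 0 < d := addOrderOf_pos t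
  have : Fintype (G ⧸ AddSubgroup.zmultiples t) := Fintype.ofFinite _
  have himg : ({S ∈ powersetCard n (univ : Finset G) | t +ᵥ S = S} : Finset (Finset G)) =
      ({T | d * #T = n} : Finset (Finset (G ⧸ AddSubgroup.zmultiples t))).image (preimageMk t) := by
    ext S
    simp only [mem_filter, mem_powersetCard, subset_univ, true_and, mem_image, mem_univ]
    constructor
    · rintro ⟨hc, hS⟩
      obtain ⟨T, rfl⟩ := exists_preimageMk_eq hS
      exact ⟨T, by rw [← hc, card_preimageMk], rfl⟩
    · rintro ⟨T, hT, rfl⟩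
      exact ⟨by rw [card_preimageMk, hT], vadd_preimageMk t T⟩
  rw [himg, card_image_of_injective _ (preimageMk_injective t)]
  split_ifs with h
  · obtain ⟨k, rfl⟩ := h
    have hcard : Fintype.card G / d = Fintype.card (G ⧸ AddSubgroup.zmultiples t) := by
      have := (AddSubgroup.zmultiples t).card_mul_index
      rw [Nat.card_zmultiples, Nat.card_eq_fintype_card, AddSubgroup.index,
        Nat.card_eq_fintype_card] at this
      rw [← this, Nat.mul_div_cancel_left _ hd]
    rw [Nat.mul_div_cancel_left _ hd, hcard, ← card_univ, ← card_powersetCard]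
    congr 1
    ext T
    simp [mem_powersetCard, hd.ne']
  · rw [card_eq_zero, filter_eq_empty_iff]
    rintro T - rfl
    exact h (dvd_mul_right _ _)

/-- The translation action on the subsets with `n` elements. -/
instance translationAction (G : Type*) [AddCommGroup G] [DecidableEq G] (n : ℕ) :
    AddAction G {S : Finset G // #S = n} where
  vadd t S := ⟨t +ᵥ S.1, by rw [card_vadd_finset, S.2]⟩
  zero_vadd S := Subtype.ext (zero_vadd G S.1)
  add_vadd a b S := Subtype.ext (add_vadd a b S.1)

/-- Burnside's lemma: both sides count pairs `(t, S)` with `t +ᵥ S = S`. -/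
theorem card_orbits_mul_card (n : ℕ) :
    Nat.card (Quotient (AddAction.orbitRel G {S : Finset G // #S = n})) * Fintype.card G =
      ∑ t : G, if addOrderOf t ∣ n then
        (Fintype.card G / addOrderOf t).choose (n / addOrderOf t) else 0 := by
  rw [← Nat.card_eq_fintype_card (α := G), ← Nat.card_prod,
    ← Nat.card_congr (AddAction.sigmaFixedByEquivOrbitsProdAddGroup G {S : Finset G // #S = n}),
    Nat.card_sigma, Nat.card_eq_fintype_card]
  refine sum_congr rfl fun t _ => ?_
  rw [← card_filter_vadd_eq, ← Fintype.card_coe, ← Nat.card_eq_fintype_card]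
  refine Nat.card_congr
    { toFun := fun S => ⟨S.1.1, ?_⟩
      invFun := fun S => ⟨⟨S.1, ?_⟩, ?_⟩
      left_inv := fun S => rfl
      right_inv := fun S => rfl }
  · rw [mem_filter, mem_powersetCard]
    exact ⟨⟨subset_univ _, S.1.2⟩, congrArg Subtype.val S.2⟩
  · exact (mem_powersetCard.1 (mem_filter.1 S.2).1).2
  · exact Subtype.ext (mem_filter.1 S.2).2

end Burnside

/-! ### Necklaces as translation orbits -/

section Necklace

variable {q : ℕ} [NeZero q]

/-- The cyclic binary word of a subset of `ZMod q`, cut at `0`. -/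
def toWord (S : Finset (ZMod q)) : List Bool :=
  List.ofFn fun i : Fin q => decide (((i : ℕ) : ZMod q) ∈ S)

omit [NeZero q] in
theorem length_toWord (S : Finset (ZMod q)) : (toWord S).length = q := by
  simp [toWord]

omit [NeZero q] in
theorem getElem_toWord (S : Finset (ZMod q)) (i : ℕ) (h : i < (toWord S).length) :
    (toWord S)[i] = decide ((i : ZMod q) ∈ S) := by
  simp [toWord]

theorem toWord_injective : Function.Injective (toWord (q := q)) := by
  intro S S' h
  ext x
  have h1 : x.val < (toWord S).length := by rw [length_toWord]; exact ZMod.val_lt x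
  have h2 : x.val < (toWord S').length := by rw [length_toWord]; exact ZMod.val_lt x
  have h3 : (toWord S)[x.val] = (toWord S')[x.val] := by simp only [h]
  rw [getElem_toWord, getElem_toWord, ZMod.natCast_zmod_val] at h3
  exact decide_eq_decide.1 h3

omit [NeZero q] in
theorem rotate_toWord (S : Finset (ZMod q)) (k : ℕ) :
    (toWord S).rotate k = toWord (-(k : ZMod q) +ᵥ S) := by
  refine List.ext_getElem (by simp [length_toWord]) fun i h1 h2 => ?_
  rw [List.getElem_rotate, getElem_toWord, getElem_toWord, length_toWord]
  rw [decide_eq_decide, mem_neg_vadd_finset_iff, ZMod.natCast_mod, vadd_eq_add, add_comm]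
  push_cast
  rfl

theorem toWord_isRotated_iff (S S' : Finset (ZMod q)) :
    toWord S ~r toWord S' ↔ ∃ t : ZMod q, t +ᵥ S = S' := by
  constructor
  · rintro ⟨k, hk⟩
    rw [rotate_toWord] at hk
    exact ⟨_, toWord_injective hk⟩
  · rintro ⟨t, rfl⟩
    -- Rotating a word by `k` translates its set by `-k`, hence the sign.
    refine ⟨(-t).val, ?_⟩
    rw [rotate_toWord, ZMod.natCast_zmod_val, neg_neg]

theorem count_true_toWord (S : Finset (ZMod q)) : (toWord S).count true = #S := by
  have hinj : Function.Injective (fun i : Fin q => ((i : ℕ) : ZMod q)) := by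
    intro i j h
    have h' := congrArg ZMod.val h
    simp only [ZMod.val_cast_of_lt i.2, ZMod.val_cast_of_lt j.2] at h'
    exact Fin.ext h'
  rw [← Multiset.coe_count, toWord, ← Fin.univ_val_map, Multiset.count_map]
  change #{i : Fin q | true = decide (((i : ℕ) : ZMod q) ∈ S)} = #S
  rw [← card_image_of_injective _ hinj]
  congr 1
  ext x
  simp only [mem_image, mem_filter, mem_univ, true_and, true_eq_decide_iff]
  constructor
  · rintro ⟨i, hi, rfl⟩; exact hi
  · intro hx
    exact ⟨⟨x.val, ZMod.val_lt x⟩, by simpa using hx, ZMod.natCast_zmod_val x⟩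

theorem exists_toWord_eq (l : List Bool) (hl : l.length = q) :
    ∃ S : Finset (ZMod q), toWord S = l := by
  classical
  refine ⟨univ.filter fun x : ZMod q => l.getD x.val false = true, ?_⟩
  refine List.ext_getElem (by rw [length_toWord, hl]) fun i h1 h2 => ?_
  rw [getElem_toWord]
  have hi : ((i : ZMod q)).val = i := ZMod.val_cast_of_lt (hl ▸ h2)
  simp [hi, h2]

/-- Necklaces with `n` black beads and `q` beads in total correspond to the orbits of translation
on the `n`-element subsets of `ZMod q`. -/
theorem ncard_necklaces {n : ℕ} (hn : n ≤ q) :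
    (necklaces n (q - n)).ncard =
      Nat.card (Quotient (AddAction.orbitRel (ZMod q) {S : Finset (ZMod q) // #S = n})) := by
  let Φ : {S : Finset (ZMod q) // #S = n} → Cycle Bool := fun S => (toWord S.1 : Cycle Bool)
  -- Once the orbit relation is the kernel of `Φ`, orbits biject with the range of `Φ`.
  have hker : AddAction.orbitRel (ZMod q) {S : Finset (ZMod q) // #S = n} = Setoid.ker Φ := by
    ext S S'
    rw [AddAction.orbitRel_apply, AddAction.mem_orbit_iff, Setoid.ker_def, Cycle.coe_eq_coe,
      List.isRotated_comm, toWord_isRotated_iff]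
    exact exists_congr fun t => Subtype.ext_iff
  have hrange : Set.range Φ = necklaces n (q - n) := by
    ext c
    constructor
    · rintro ⟨S, rfl⟩
      have h1 := count_true_toWord S.1
      have h2 := List.count_not_add_count (toWord S.1) true
      rw [length_toWord, h1, S.2, Bool.not_true] at h2
      refine ⟨?_, ?_⟩
      · rw [Cycle.coe_toMultiset, Multiset.coe_count, h1, S.2]
      · rw [Cycle.coe_toMultiset, Multiset.coe_count]
        omega
    · induction c using Quotient.inductionOn with
      | h l =>
      rintro ⟨h1, h2⟩
      change ((l : Cycle Bool).toMultiset).count true = n at h1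
      change ((l : Cycle Bool).toMultiset).count false = q - n at h2
      rw [Cycle.coe_toMultiset, Multiset.coe_count] at h1 h2
      have h3 := List.count_not_add_count l true
      rw [h1, Bool.not_true, h2] at h3
      obtain ⟨S, rfl⟩ := exists_toWord_eq l (by omega : l.length = q)
      exact ⟨⟨S, by rw [← count_true_toWord, h1]⟩, rfl⟩
  rw [← hrange, hker, Nat.card_congr (Setoid.quotientKerEquivRange Φ), Nat.card_coe_set_eq]

end Necklace

end ArithTutte

end

theorem theorem1p13 (n q : ℕ) (hn : Odd n) (hq : 0 < q) (hnq : n ∣ q) :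
    (((ArithTutte.charPolyWeightA n).eval (q : ℤ) : ℤ) : ℚ) / (n.factorial : ℚ) =
      ((ArithTutte.necklaces n (q - n)).ncard : ℚ) := by
  have : NeZero q := ⟨hq.ne'⟩
  have h1 := ArithTutte.modulus_mul_card_sum_eq_zero (q := q) hn
  have h2 := ArithTutte.card_orbits_mul_card (G := ZMod q) n
  rw [ZMod.card, ← h1, mul_comm] at h2
  -- `h2` now equates `q` times the orbit count with `q` times the zero-sum count, so `q` cancels.
  rw [ArithTutte.ncard_necklaces (Nat.le_of_dvd hq hnq), Nat.eq_of_mul_eq_mul_left hq h2,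
    ArithTutte.eval_charPolyWeightA_eq_card hn.pos hnq]
  push_cast
  rw [mul_div_cancel_left₀ _ (by exact_mod_cast n.factorial_ne_zero)]
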